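/- Let $\Lambda$ be a countable finitely aligned higher-rank graph of rank $k$: a countable small category with a degree functor $d:\Lambda\to\mathbb N^k$ such that whenever $d(\lambda)=m+n$ there are unique $\mu,\nu$ with $\lambda=\mu\nu$, $d(\mu)=m$, $d(\nu)=n$, and such that for all $\lambda,\mu\in\Lambda$ the set $\Lambda^{\min}(\lambda,\mu)=\{(\rho,\tau):\lambda\rho=\mu\tau,\ d(\lambda\rho)=d(\lambda)\vee d(\mu)\}$ is finite. Write $r,s$ for range and source, $\Lambda^0$ for the set of vertices (objects), and $v\Lambda$ for the set of paths with range $v$. A set $E\subseteq v\Lambda$ is exhaustive if for every $\lambda\in v\Lambda$ there is $\mu\in E$ with $\Lambda^{\min}(\lambda,\mu)\neq\emptyset$. For $m\in(\mathbb N\cup\{\infty\})^k$ let $\Omega_{k,m}$ be the higher-rank graph with objects the $p\in\mathbb N^k$ with $p\le m$ and with exactly one path $(p,q)$, of range $p$, source $q$ and degree $q-p$, for each pair $p\le q\le m$. A boundary path of degree $d(x)=m$ is a degree-preserving functor $x:\Omega_{k,m}\to\Lambda$ such that for every $n\in\mathbb N^k$ with $n\le m$ and every finite exhaustive set $E\subseteq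 x(n)\Lambda\setminus\{x(n)\}$ there is $\lambda\in E$ with $n+d(\lambda)\le m$ and $x(n,n+d(\lambda))=\lambda$. Let $\partial\Lambda$ be the set of boundary paths; for $p\le d(x)$ let $\sigma^p(x)$ be the shifted boundary path $(a,b)\mapsto x(a+p,b+p)$ of degree $d(x)-p$; for $\mu\in\Lambda$ let $Z(\mu)=\{\mu x\in\partial\Lambda\}$ be the set of boundary paths with initial segment $\mu$, and for finite $F\subseteq s(\mu)\Lambda$ let $Z(\mu\setminus F)=Z(\mu)\setminus\bigcup_{\nu\in F}Z(\mu\nu)$. Give $\partial\Lambda$ the topology with base the sets $Z(\mu\setminus F)$. The boundary path groupoid $\mathcal G_\Lambda$ has unit space $\mathcal G_\Lambda^0=\partial\Lambda$ and arrows $(x,p-q,y)$, from $y$ to $x$, for $x,y\in\partial\Lambda$, $p\le d(x)$, $q\le d(y)$ with $\sigma^p(x)=\sigma^q(y)$, with product $(x,m,y)(y,n,z)=(x,m+n,z)$. Let $\mathrm{Orb}_x$ be the orbit of $x$, that is, the set of $y\in\partial\Lambda$ for which $\sigma^p(x)=\sigma^q(y)$ for some $p\le d(x)$, $q\le d(y)$,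 and let $\mathcal G_\Lambda^0/\mathcal G_\Lambda$ be the orbit space with the quotient topology. Then $\mathcal G_\Lambda^0/\mathcal G_\Lambda$ is $T_1$ if and only if for each $x\in\partial\Lambda$ and each $v\in\Lambda^0$ the set $Z(v)\cap\mathrm{Orb}_x$ is finite. -/

import Mathlib

open CategoryTheory

universe v u v' u'

namespace HRG

/-- A higher-rank graph of rank `k` (a `k`-graph): a small category `Λ` with a degree functor to the
monoid `ℕ^k` (seen as a category with one object) that has the unique factorisation property.
The objects of `Λ` are the vertices.  A path `f : u ⟶ v` has source `u` and range `v`; the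
composite `λμ` of paths with `s(λ) = r(μ)` is `μ ≫ λ`. -/
class HigherRankGraph (k : outParam ℕ) (Λ : Type u) [Category.{v} Λ] where
  /-- the degree of a path -/
  degree : ∀ {a b : Λ}, (a ⟶ b) → (Fin k → ℕ)
  degree_id : ∀ a : Λ, degree (𝟙 a) = 0
  degree_comp : ∀ {a b c : Λ} (f : a ⟶ b) (g : b ⟶ c), degree (f ≫ g) = degree g + degree f
  /-- if `d(λ) = m + n` then `λ = μν` for unique `μ`, `ν` with `d(μ) = m` and `d(ν) = n` -/
  factorisation : ∀ {a b : Λ} (f : a ⟶ b) (m n : Fin k → ℕ), degree f = m + n →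
    ∃! t : Σ c : Λ, (a ⟶ c) × (c ⟶ b),
      t.2.1 ≫ t.2.2 = f ∧ degree t.2.2 = m ∧ degree t.2.1 = n

/-- The set `vΛ` of all paths with range `v`. -/
abbrev PathsInto {Λ : Type u} [Category.{v} Λ] (w : Λ) : Type (max u v) := Σ a : Λ, (a ⟶ w)

section Alignment

variable {k : ℕ} {Λ : Type u} [Category.{v} Λ] [HigherRankGraph k Λ]

/-- The set `Λ^min(λ, μ)` of pairs `(ρ, τ)` with `λρ = μτ` and `d(λρ) = d(λ) ∨ d(μ)`
(it is empty by definition if `λ` and `μ` have different ranges). -/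
def minExt {a b w : Λ} (l : a ⟶ w) (m : b ⟶ w) : Set (Σ c : Λ, (c ⟶ a) × (c ⟶ b)) :=
  {t | t.2.1 ≫ l = t.2.2 ≫ m ∧
    HigherRankGraph.degree (t.2.1 ≫ l) = HigherRankGraph.degree l ⊔ HigherRankGraph.degree m}

/-- `E ⊆ vΛ` is exhaustive if every path with range `v` has a common extension with
some element of `E`. -/
def IsExhaustive {w : Λ} (E : Set (PathsInto w)) : Prop :=
  ∀ l : PathsInto w, ∃ m ∈ E, (minExt l.2 m.2).Nonempty

variable (Λ) in
/-- `Λ` is finitely aligned if every `Λ^min(λ, μ)` is finite. -/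
def FinitelyAligned : Prop :=
  ∀ {a b w : Λ} (l : a ⟶ w) (m : b ⟶ w), (minExt l m).Finite

end Alignment

/-- A morphism of `k`-graphs: a degree-preserving functor. -/
structure GraphMorphism {k : ℕ} (Γ : Type u) [Category.{v} Γ] [HigherRankGraph k Γ]
    (Λ : Type u') [Category.{v'} Λ] [HigherRankGraph k Λ] extends Γ ⥤ Λ where
  degree_map : ∀ {a b : Γ} (f : a ⟶ b),
    HigherRankGraph.degree (toFunctor.map f) = HigherRankGraph.degree f

/-- The objects of the `k`-graph `Ω_{k,m}`, where `m ∈ (ℕ ∪ {∞})^k`: all `p ∈ ℕ^k` with `p ≤ m`. -/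
@[ext]
structure Omega {k : ℕ} (m : Fin k → ℕ∞) where
  val : Fin k → ℕ
  le : ∀ i, (val i : ℕ∞) ≤ m i

namespace Omega

variable {k : ℕ} {m : Fin k → ℕ∞}

/-- There is exactly one path `(p, q)` with range `p` and source `q` when `p ≤ q`, and none
otherwise. -/
instance : Category (Omega m) where
  Hom q p := PLift (p.val ≤ q.val)
  id p := ⟨le_rfl⟩
  comp f g := ⟨g.down.trans f.down⟩

instance (p q : Omega m) : Subsingleton (q ⟶ p) := inferInstanceAs (Subsingleton (PLift _))

/-- The path `(p, q)` has degree `q - p`. -/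
instance : HigherRankGraph k (Omega m) where
  degree {q p} _ := q.val - p.val
  degree_id p := by simp
  degree_comp {a b c} f g := by
    funext i
    have h1 : b.val i ≤ a.val i := f.down i
    have h2 : c.val i ≤ b.val i := g.down i
    simp only [Pi.add_apply, Pi.sub_apply]
    omega
  factorisation {q p} f m' n h := by
    have hf : ∀ i, p.val i ≤ q.val i := f.down
    have hi : ∀ i, q.val i - p.val i = m' i + n i := fun i => congrFun h i
    refine ⟨⟨⟨p.val + m', fun i => ?_⟩, ⟨fun i => ?_⟩, ⟨fun i => ?_⟩⟩, ⟨?_, ?_, ?_⟩, ?_⟩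
    · refine le_trans ?_ (q.le i)
      have h1 := hf i
      have h2 := hi i
      simp only [Pi.add_apply]
      exact_mod_cast (by omega : p.val i + m' i ≤ q.val i)
    · have h1 := hf i
      have h2 := hi i
      simp only [Pi.add_apply]
      omega
    · simp
    · exact Subsingleton.elim _ _
    · funext i
      simp
    · funext i
      have h1 := hf i
      have h2 := hi i
      simp only [Pi.add_apply, Pi.sub_apply]
      omega
    · rintro ⟨c, g, g'⟩ ⟨-, h1, -⟩
      have hc : c = ⟨p.val + m', fun i => by
          refine le_trans ?_ (q.le i)
          have h1 := hf i
          have h2 := hi i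
          simp only [Pi.add_apply]
          exact_mod_cast (by omega : p.val i + m' i ≤ q.val i)⟩ := by
        ext i
        have h2 : p.val i ≤ c.val i := g'.down i
        have h3 : c.val i - p.val i = m' i := congrFun h1 i
        simp only [Pi.add_apply]
        omega
      subst hc
      congr

/-- The object `0` of `Ω_{k,m}`. -/
def zero : Omega m := ⟨0, fun i => by simp⟩

/-- The path `(0, p)` of `Ω_{k,m}`. -/
def fromZero (p : Omega m) : p ⟶ (zero : Omega m) := ⟨fun _ => Nat.zero_le _⟩

/-- `p + n ≤ m` for `p ≤ m - n` and `n ≤ m`. -/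
def add (n : Omega m) (p : Omega (fun i => m i - (n.val i : ℕ∞))) : Omega m :=
  ⟨p.val + n.val, fun i => by
    have h := add_le_add_left (p.le i) (n.val i : ℕ∞)
    rw [tsub_add_cancel_of_le (n.le i)] at h
    simpa using h⟩

/-- The functor `Ω_{k,m-n} → Ω_{k,m}`, `(p, q) ↦ (p + n, q + n)`. -/
def translate (n : Omega m) : Omega (fun i => m i - (n.val i : ℕ∞)) ⥤ Omega m where
  obj p := add n p
  map f := ⟨fun i => Nat.add_le_add_right (f.down i) _⟩

end Omega

/-- A boundary path of `Λ`: a `k`-graph morphism `x : Ω_{k,m} → Λ` with `m ∈ (ℕ ∪ {∞})^k` such that,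
for every `n ∈ ℕ^k` with `n ≤ m` and every finite exhaustive set `E ⊆ x(n)Λ ∖ {x(n)}`, some
`λ ∈ E` is the segment `x(n, q)` of `x` for some `q` (necessarily `q = n + d(λ)`, since `x`
preserves degrees). -/
structure BoundaryPath {k : ℕ} (Λ : Type u) [Category.{v} Λ] [HigherRankGraph k Λ] where
  /-- the degree `d(x) = m` of the path -/
  deg : Fin k → ℕ∞
  path : GraphMorphism (Omega deg) Λ
  boundary : ∀ (n : Omega deg) (E : Set (PathsInto (path.obj n))),
    E.Finite → IsExhaustive E → (⟨path.obj n, 𝟙 _⟩ : PathsInto (path.obj n)) ∉ E →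
    ∃ l ∈ E, ∃ (q : Omega deg) (f : q ⟶ n),
      (⟨path.obj q, path.map f⟩ : PathsInto (path.obj n)) = l

namespace BoundaryPath

variable {k : ℕ} {Λ : Type u} [Category.{v} Λ] [HigherRankGraph k Λ]

theorem ext_of_segments {x y : BoundaryPath Λ} (h : x.deg = y.deg)
    (h' : ∀ (p q : Omega x.deg) (p' q' : Omega y.deg) (f : q ⟶ p) (f' : q' ⟶ p'),
      p.val = p'.val → q.val = q'.val →
        Arrow.mk (x.path.map f) = Arrow.mk (y.path.map f')) : x = y := by
  obtain ⟨m, ⟨F, hF⟩, hx⟩ := x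
  obtain ⟨m', ⟨G, hG⟩, hy⟩ := y
  dsimp only at h h'
  subst h
  have : F = G := by
    refine CategoryTheory.Functor.hext (fun p => ?_) (fun q p f => ?_)
    · exact congrArg Comma.left (h' p p p p (𝟙 p) (𝟙 p) rfl rfl)
    · have e := h' p q p q f f rfl rfl
      rw [Arrow.mk_eq_mk_iff] at e
      obtain ⟨e1, e2, e3⟩ := e
      rw [e3]
      simp
  subst this
  rfl

/-- The shift `σ^n(x) : Ω_{k,d(x)-n} → Λ`, `(p, q) ↦ x(p + n, q + n)`, for `n ≤ d(x)`. -/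
def shift (x : BoundaryPath Λ) (n : Omega x.deg) : BoundaryPath Λ where
  deg i := x.deg i - (n.val i : ℕ∞)
  path :=
    { toFunctor := n.translate ⋙ x.path.toFunctor
      degree_map := fun {q p} f => by
        refine (x.path.degree_map _).trans ?_
        funext i
        exact Nat.add_sub_add_right _ _ _ }
  boundary p E hE hex hid := by
    obtain ⟨l, hl, q, f, h⟩ := x.boundary (n.add p) E hE hex hid
    have hnq : ∀ i, n.val i ≤ q.val i := fun i => le_trans (Nat.le_add_left _ _) (f.down i)
    obtain ⟨q', rfl⟩ : ∃ q', n.add q' = q := by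
      refine ⟨⟨fun i => q.val i - n.val i, fun i => ?_⟩, ?_⟩
      · rw [ENat.natCast_sub]
        exact tsub_le_tsub_right (q.le i) _
      · ext i
        exact Nat.sub_add_cancel (hnq i)
    exact ⟨l, hl, q', ⟨fun i => Nat.le_of_add_le_add_right (f.down i)⟩, h⟩

theorem shift_add (x : BoundaryPath Λ) (n : Omega x.deg) (p : Omega (x.shift n).deg) :
    (x.shift n).shift p = x.shift (n.add p) := by
  refine ext_of_segments ?_ ?_
  · funext i
    change x.deg i - (n.val i : ℕ∞) - (p.val i : ℕ∞) = x.deg i - ((p.val i + n.val i : ℕ) : ℕ∞)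
    rw [tsub_tsub, Nat.cast_add, add_comm]
  · intro a b a' b' f f' ha hb
    have h1 : n.add (p.add a) = (n.add p).add a' := by
      ext i
      have := congrFun ha i
      change a.val i + p.val i + n.val i = a'.val i + (p.val i + n.val i)
      omega
    have h2 : n.add (p.add b) = (n.add p).add b' := by
      ext i
      have := congrFun hb i
      change b.val i + p.val i + n.val i = b'.val i + (p.val i + n.val i)
      omega
    have key : ∀ {c d c' d' : Omega x.deg} (g : d ⟶ c) (g' : d' ⟶ c'), c = c' → d = d' →
        Arrow.mk (x.path.map g) = Arrow.mk (x.path.map g') := by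
      rintro c d c' d' g g' rfl rfl
      rw [Subsingleton.elim g g']
    exact key _ _ h1 h2

/-- `y = μx`, the concatenation of the path `μ` with the boundary path `x`, `r(x) = s(μ)`: the
boundary path with `y(0, d(μ)) = μ` and `σ^{d(μ)}(y) = x`. -/
def IsConcat {a w : Λ} (m : a ⟶ w) (x y : BoundaryPath Λ) : Prop :=
  ∃ n : Omega y.deg, n.val = HigherRankGraph.degree m ∧
    Arrow.mk (y.path.map n.fromZero) = Arrow.mk m ∧ y.shift n = x

/-- The cylinder set `Z(μ) = {μx ∈ ∂Λ}`. -/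
def cylinder {a w : Λ} (m : a ⟶ w) : Set (BoundaryPath Λ) :=
  {y | ∃ x : BoundaryPath Λ, IsConcat m x y}

/-- The set `Z(μ ∖ F) = Z(μ) ∖ ⋃_{ν ∈ F} Z(μν)`, where `F ⊆ s(μ)Λ`. -/
def cylinderDiff {a w : Λ} (m : a ⟶ w) (F : Set (PathsInto a)) : Set (BoundaryPath Λ) :=
  cylinder m \ ⋃ n ∈ F, cylinder (n.2 ≫ m)

/-- The topology on `∂Λ` generated by the sets `Z(μ ∖ F)` with `F` finite. -/
instance : TopologicalSpace (BoundaryPath Λ) :=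
  TopologicalSpace.generateFrom
    {U | ∃ (a w : Λ) (m : a ⟶ w) (F : Set (PathsInto a)), F.Finite ∧ U = cylinderDiff m F}

/-- The integer vectors `m` such that `(x, m, y)` is an arrow of the boundary path groupoid:
`m = p - q` for some `p ≤ d(x)` and `q ≤ d(y)` with `σ^p(x) = σ^q(y)`. -/
def IsLag (x : BoundaryPath Λ) (m : Fin k → ℤ) (y : BoundaryPath Λ) : Prop :=
  ∃ (p : Omega x.deg) (q : Omega y.deg),
    (∀ i, m i = (p.val i : ℤ) - (q.val i : ℤ)) ∧ x.shift p = y.shift q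

theorem IsLag.refl (x : BoundaryPath Λ) : IsLag x 0 x :=
  ⟨Omega.zero, Omega.zero, fun i => by simp, rfl⟩

theorem IsLag.symm {x y : BoundaryPath Λ} {m : Fin k → ℤ} (h : IsLag x m y) :
    IsLag y (-m) x := by
  obtain ⟨p, q, hm, h⟩ := h
  exact ⟨q, p, fun i => by simp [hm i], h.symm⟩

theorem exists_shift_eq {x y : BoundaryPath Λ} (p : Omega x.deg) (q r : Omega y.deg)
    (h : x.shift p = y.shift q) (hqr : ∀ i, q.val i ≤ r.val i) :
    ∃ p' : Omega x.deg, (∀ i, p'.val i + q.val i = p.val i + r.val i) ∧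
      x.shift p' = y.shift r := by
  have hdeg : ∀ i, x.deg i - (p.val i : ℕ∞) = y.deg i - (q.val i : ℕ∞) :=
    fun i => congrFun (congrArg BoundaryPath.deg h) i
  let c' : Omega (y.shift q).deg := ⟨fun i => r.val i - q.val i, fun i => by
    rw [ENat.natCast_sub]
    exact tsub_le_tsub_right (r.le i) _⟩
  let c : Omega (x.shift p).deg := ⟨fun i => r.val i - q.val i, fun i => by
    change _ ≤ x.deg i - (p.val i : ℕ∞)
    rw [hdeg i]
    exact c'.le i⟩
  refine ⟨p.add c, fun i => ?_, ?_⟩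
  · have := hqr i
    change r.val i - q.val i + p.val i + q.val i = p.val i + r.val i
    omega
  · have hr : r = q.add c' := by
      ext i
      exact (Nat.sub_add_cancel (hqr i)).symm
    rw [hr, ← shift_add, ← shift_add]
    have key : ∀ (a b : BoundaryPath Λ) (s : Omega a.deg) (t : Omega b.deg), a = b →
        s.val = t.val → a.shift s = b.shift t := by
      rintro a _ s t rfl hst
      rw [Omega.ext hst]
    exact key _ _ _ _ h rfl

theorem IsLag.trans {x y z : BoundaryPath Λ} {m n : Fin k → ℤ} (h : IsLag x m y)
    (h' : IsLag y n z) : IsLag x (m + n) z := by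
  obtain ⟨p, q, hm, h⟩ := h
  obtain ⟨p', q', hn, h'⟩ := h'
  let r : Omega y.deg := ⟨q.val ⊔ p'.val, fun i => by
    rcases le_total (q.val i) (p'.val i) with hle | hle
    · simpa [hle] using p'.le i
    · simpa [hle] using q.le i⟩
  obtain ⟨a, ha, hxa⟩ := exists_shift_eq p q r h (fun i => le_sup_left)
  obtain ⟨b, hb, hzb⟩ := exists_shift_eq q' p' r h'.symm (fun i => le_sup_right)
  refine ⟨a, b, fun i => ?_, hxa.trans hzb.symm⟩
  have h1 := ha i
  have h2 := hb i
  have h3 := hm i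
  have h4 := hn i
  simp only [Pi.add_apply]
  omega

/-- The boundary path groupoid, with unit space `∂Λ`: the arrows with source `y` and range `x` are
the triples `(x, m, y)`; the product of `(x, m, y)` and `(y, n, z)` is `(x, m + n, z)` and the
inverse of `(x, m, y)` is `(y, -m, x)`. -/
instance boundaryPathGroupoid : Groupoid (BoundaryPath Λ) where
  Hom y x := {m : Fin k → ℤ // IsLag x m y}
  id x := ⟨0, IsLag.refl x⟩
  comp f g := ⟨g.1 + f.1, g.2.trans f.2⟩
  inv f := ⟨-f.1, f.2.symm⟩
  id_comp _ := Subtype.ext (add_zero _)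
  comp_id _ := Subtype.ext (zero_add _)
  assoc _ _ _ := Subtype.ext (add_assoc _ _ _).symm
  inv_comp _ := Subtype.ext (add_neg_cancel _)
  comp_inv _ := Subtype.ext (neg_add_cancel _)

end BoundaryPath

/-- The orbit equivalence relation on the units of a groupoid. -/
def orbitSetoid (G : Type u) [Groupoid.{v} G] : Setoid G where
  r x y := Nonempty (x ⟶ y)
  iseqv :=
    { refl := fun x => ⟨𝟙 x⟩
      symm := fun ⟨f⟩ => ⟨Groupoid.inv f⟩
      trans := fun ⟨f⟩ ⟨g⟩ => ⟨f ≫ g⟩ }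

/-- The orbit of a unit `x` of a groupoid. -/
def orbit {G : Type u} [Groupoid.{v} G] (x : G) : Set G := {y | Nonempty (x ⟶ y)}

/-- The orbit space of a groupoid; if the unit space has a topology, it has the quotient
topology. -/
abbrev OrbitSpace (G : Type u) [Groupoid.{v} G] : Type u := Quotient (orbitSetoid G)

end HRG

/-! The points of the orbit space are closed exactly when the orbits are closed in `∂Λ`, so the
claim is that an orbit is closed if and only if it meets every `Z(v)` in a finite set. The sets
`Z(v)` are open and partition the Hausdorff space `∂Λ`, so finite intersections force the orbit to
be closed.

Conversely, let `Orb_x` be closed. Finite alignment makes `Z(v)` compact, so `K = Z(v) ∩ Orb_x` is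
compact Hausdorff; it is countable because `Λ` is. By Baire, a nonempty such `K` has an isolated
point. The continuous maps `λz ↦ μz` carry isolation to every other point of the orbit, so `K` is
discrete and compact, hence finite.

Two facts about path space carry this: a boundary path is determined by the cylinders containing it
(`eq_of_forall_cylinder`), and every boundary filter comes from a boundary path
(`IsBoundaryFilter.exists_boundaryPath`). The latter gives both the concatenations `μx`
(`exists_isConcat`) and the limits of ultrafilters (`isCompact_cylinder_id`). -/

namespace HRG

open HigherRankGraph

section PathSpace

variable {k : ℕ} {Λ : Type u} [Category.{v} Λ] [HigherRankGraph k Λ]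

/-! ### Unique factorisation, cancellation and exhaustive sets. -/

section Paths

theorem sigma_eq_of_comp_eq {a b b' w : Λ} {f : a ⟶ b} {g : b ⟶ w} {f' : a ⟶ b'} {g' : b' ⟶ w}
    (h : f ≫ g = f' ≫ g') (hd : degree g = degree g') :
    (⟨b, f, g⟩ : Σ c : Λ, (a ⟶ c) × (c ⟶ w)) = ⟨b', f', g'⟩ := by
  have e : degree f = degree f' := by
    have := congrArg degree h
    rw [degree_comp, degree_comp, hd] at this
    exact add_left_cancel this
  exact (factorisation (f ≫ g) (degree g) (degree f) (degree_comp f g)).unique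
    ⟨rfl, rfl, rfl⟩ ⟨h.symm, hd.symm, e.symm⟩

theorem pathsInto_eq_of_comp_eq {a b b' w : Λ} {f : a ⟶ b} {g : b ⟶ w} {f' : a ⟶ b'} {g' : b' ⟶ w}
    (h : f ≫ g = f' ≫ g') (hd : degree g = degree g') :
    (⟨b, g⟩ : PathsInto w) = ⟨b', g'⟩ := by
  have := sigma_eq_of_comp_eq h hd
  cases this
  rfl

theorem comp_right_cancel {k : ℕ} {Λ : Type u} [Category.{v} Λ] [HigherRankGraph k Λ]
    {a b w : Λ} {f f' : a ⟶ b} {g : b ⟶ w} (h : f ≫ g = f' ≫ g) :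
    f = f' := by
  have := sigma_eq_of_comp_eq h rfl
  cases this
  rfl

theorem eq_id_of_degree_eq_zero {a w : Λ} (f : a ⟶ w) (h : degree f = 0) :
    (⟨a, f⟩ : PathsInto w) = ⟨w, 𝟙 w⟩ :=
  pathsInto_eq_of_comp_eq (f := 𝟙 a) (f' := f) (by simp) (by rw [h, degree_id])

theorem exists_initial_segment {a w : Λ} (f : a ⟶ w) {n : Fin k → ℕ} (h : n ≤ degree f) :
    ∃ (c : Λ) (p : a ⟶ c) (q : c ⟶ w), p ≫ q = f ∧ degree q = n := by
  obtain ⟨⟨c, p, q⟩, ⟨h1, h2, -⟩, -⟩ :=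
    factorisation f n (degree f - n) (add_tsub_cancel_of_le h).symm
  exact ⟨c, p, q, h1, h2⟩

theorem exists_comp_eq_of_degree_le {a b b' w : Λ} {f : a ⟶ b} {g : b ⟶ w} {f' : a ⟶ b'}
    {g' : b' ⟶ w} (h : f ≫ g = f' ≫ g') (hd : degree g ≤ degree g') :
    ∃ p : b' ⟶ b, p ≫ g = g' ∧ f' ≫ p = f := by
  obtain ⟨c, p, q, rfl, hq⟩ := exists_initial_segment g' hd
  rw [← Category.assoc] at h
  have := sigma_eq_of_comp_eq h hq.symm
  cases this
  exact ⟨p, rfl, rfl⟩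

/-- A common extension of two paths factors through a minimal one. -/
theorem exists_minExt_of_comp_eq {a b c w : Λ} {l : a ⟶ w} {m : b ⟶ w} {f : c ⟶ a} {g : c ⟶ b}
    (h : f ≫ l = g ≫ m) :
    ∃ t ∈ minExt l m, ∃ p : c ⟶ t.1, p ≫ t.2.1 = f ∧ p ≫ t.2.2 = g := by
  have hle : degree l ⊔ degree m ≤ degree (f ≫ l) := by
    refine sup_le ?_ ?_
    · rw [degree_comp]; exact le_self_add
    · rw [h, degree_comp]; exact le_self_add
  obtain ⟨d, p, q, hpq, hq⟩ := exists_initial_segment _ hle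
  obtain ⟨f', hf', hf⟩ := exists_comp_eq_of_degree_le hpq.symm (hq ▸ le_sup_left)
  obtain ⟨g', hg', hg⟩ := exists_comp_eq_of_degree_le (h.symm.trans hpq.symm) (hq ▸ le_sup_right)
  exact ⟨⟨d, f', g'⟩, ⟨hf'.trans hg'.symm, (congrArg degree hf').trans hq⟩, p, hf, hg⟩

/-- Cancellation for arrows whose endpoints agree only propositionally, as happens when segments of
two boundary paths are compared. -/
theorem arrow_eq_of_comp_eq {k : ℕ} {Λ : Type u} [Category.{v} Λ] [HigherRankGraph k Λ]
    {a b c a' b' c' : Λ} {f : a ⟶ b} {g : b ⟶ c} {f' : a' ⟶ b'}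
    {g' : b' ⟶ c'} (h : Arrow.mk g = Arrow.mk g') (h' : Arrow.mk (f ≫ g) = Arrow.mk (f' ≫ g')) :
    Arrow.mk f = Arrow.mk f' := by
  rw [Arrow.mk_eq_mk_iff] at h h'
  obtain ⟨rfl, rfl, h⟩ := h
  obtain ⟨rfl, _, h'⟩ := h'
  simp only [eqToHom_refl, Category.comp_id, Category.id_comp] at h h'
  subst h
  rw [comp_right_cancel h']

theorem degree_eq_of_arrow_eq {a b a' b' : Λ} {f : a ⟶ b} {f' : a' ⟶ b'}
    (h : Arrow.mk f = Arrow.mk f') : degree f = degree f' := by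
  rw [Arrow.mk_eq_mk_iff] at h
  obtain ⟨rfl, rfl, h⟩ := h
  simp only [eqToHom_refl, Category.comp_id, Category.id_comp] at h
  rw [h]

theorem arrow_eq_of_pathsInto_eq {w : Λ} {l m : PathsInto w} (h : l = m) :
    Arrow.mk l.2 = Arrow.mk m.2 := by
  rw [h]

theorem pathsInto_eq_of_arrow_eq {a b w : Λ} {l : a ⟶ w} {m : b ⟶ w}
    (h : Arrow.mk l = Arrow.mk m) : (⟨a, l⟩ : PathsInto w) = ⟨b, m⟩ := by
  rw [Arrow.mk_eq_mk_iff] at h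
  obtain ⟨rfl, _, h⟩ := h
  simp only [eqToHom_refl, Category.comp_id, Category.id_comp] at h
  rw [h]

/-- The paths `ρ` with `(ρ, τ) ∈ Λ^min(ν, ε)` for some `ε ∈ E`. -/
def extensions {a w : Λ} (n : a ⟶ w) (E : Set (PathsInto w)) : Set (PathsInto a) :=
  ⋃ e ∈ E, (fun t : Σ c : Λ, (c ⟶ a) × (c ⟶ e.1) => (⟨t.1, t.2.1⟩ : PathsInto a)) '' minExt n e.2

theorem extensions_finite (hΛ : FinitelyAligned Λ) {a w : Λ} (n : a ⟶ w) {E : Set (PathsInto w)}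
    (hE : E.Finite) : (extensions n E).Finite :=
  hE.biUnion fun e _ => (hΛ n e.2).image _

/-- Extending `l ≫ n` until it meets some `e ∈ E` gives a common extension of `n` and `e`; it
factors through a minimal one, whose first component then has a common extension with `l`. -/
theorem IsExhaustive.extensions {a w : Λ} (n : a ⟶ w) {E : Set (PathsInto w)}
    (hE : IsExhaustive E) : IsExhaustive (extensions n E) := by
  rintro ⟨b, l⟩
  obtain ⟨e, he, ⟨c, f, g⟩, hfg, -⟩ := hE ⟨b, l ≫ n⟩
  dsimp only at f g hfg
  rw [← Category.assoc] at hfg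
  obtain ⟨t, ht, p, hp, -⟩ := exists_minExt_of_comp_eq hfg
  obtain ⟨s, hs, -⟩ := exists_minExt_of_comp_eq hp.symm
  exact ⟨_, Set.mem_biUnion he ⟨t, ht, rfl⟩, s, hs⟩

end Paths

/-! ### Cylinder sets, shifts and concatenation. -/

namespace BoundaryPath

theorem arrow_map_eq (x : BoundaryPath Λ) {p q p' q' : Omega x.deg} (f : q ⟶ p) (f' : q' ⟶ p')
    (hp : p = p') (hq : q = q') : Arrow.mk (x.path.map f) = Arrow.mk (x.path.map f') := by
  subst hp hq
  rw [Subsingleton.elim f f']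

theorem degree_map_fromZero (x : BoundaryPath Λ) (n : Omega x.deg) :
    degree (x.path.map n.fromZero) = n.val :=
  (x.path.degree_map _).trans (funext fun _ => Nat.sub_zero _)

theorem map_comp_map_fromZero (x : BoundaryPath Λ) {p q : Omega x.deg} (f : q ⟶ p) :
    x.path.map f ≫ x.path.map p.fromZero = x.path.map q.fromZero := by
  rw [← x.path.map_comp]
  exact congrArg x.path.map (Subsingleton.elim _ _)

theorem mem_cylinder_iff {a w : Λ} {m : a ⟶ w} {y : BoundaryPath Λ} :
    y ∈ cylinder m ↔ ∃ n : Omega y.deg, Arrow.mk (y.path.map n.fromZero) = Arrow.mk m := by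
  constructor
  · rintro ⟨-, n, -, h, -⟩
    exact ⟨n, h⟩
  · rintro ⟨n, h⟩
    exact ⟨_, n, by rw [← degree_eq_of_arrow_eq h, degree_map_fromZero], h, rfl⟩

theorem mem_cylinder_map (y : BoundaryPath Λ) (n : Omega y.deg) :
    y ∈ cylinder (y.path.map n.fromZero) :=
  mem_cylinder_iff.2 ⟨n, rfl⟩

/-- Eliminates membership in a cylinder set, replacing the path by an initial segment. -/
theorem cylinder_induction {y : BoundaryPath Λ} {P : ∀ {a w : Λ}, (a ⟶ w) → Prop}
    (h : ∀ n : Omega y.deg, P (y.path.map n.fromZero)) {a w : Λ} {m : a ⟶ w}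
    (hm : y ∈ cylinder m) : P m := by
  obtain ⟨n, hn⟩ := mem_cylinder_iff.1 hm
  rw [Arrow.mk_eq_mk_iff] at hn
  obtain ⟨rfl, rfl, hn⟩ := hn
  simp only [eqToHom_refl, Category.comp_id, Category.id_comp] at hn
  exact hn ▸ h n

theorem range_eq_of_mem_cylinder {y : BoundaryPath Λ} {a w : Λ} {m : a ⟶ w}
    (h : y ∈ cylinder m) : y.path.obj Omega.zero = w :=
  cylinder_induction (P := fun {_ w} _ => y.path.obj Omega.zero = w) (fun _ => rfl) h

theorem cylinder_comp_subset {a b w : Λ} (f : b ⟶ a) (m : a ⟶ w) :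
    cylinder (k := k) (f ≫ m) ⊆ cylinder m := by
  intro y hy
  obtain ⟨n, hn⟩ := mem_cylinder_iff.1 hy
  have hd := degree_eq_of_arrow_eq hn
  rw [degree_map_fromZero, degree_comp] at hd
  rw [Arrow.mk_eq_mk_iff] at hn
  obtain ⟨rfl, rfl, hn⟩ := hn
  simp only [eqToHom_refl, Category.comp_id, Category.id_comp] at hn
  let p : Omega y.deg := ⟨degree m, fun i => le_trans (by rw [hd]; simp) (n.le i)⟩
  let g : n ⟶ p := ⟨by rw [hd]; exact le_self_add⟩
  refine mem_cylinder_iff.2 ⟨p, arrow_eq_of_pathsInto_eq (l := ⟨_, _⟩) (m := ⟨_, m⟩)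
    (pathsInto_eq_of_comp_eq (f := y.path.map g) (f' := f) ?_ (degree_map_fromZero _ _))⟩
  rw [map_comp_map_fromZero, hn]

theorem cylinder_subset_id {a w : Λ} (m : a ⟶ w) :
    cylinder (k := k) m ⊆ cylinder (𝟙 w) := by
  simpa using cylinder_comp_subset (k := k) m (𝟙 w)

theorem mem_cylinder_id_iff {y : BoundaryPath Λ} {w : Λ} :
    y ∈ cylinder (𝟙 w) ↔ y.path.obj Omega.zero = w := by
  refine ⟨range_eq_of_mem_cylinder, ?_⟩
  rintro rfl
  exact cylinder_subset_id _ (mem_cylinder_map y Omega.zero)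

theorem exists_minExt_of_mem_cylinder {y : BoundaryPath Λ} {a b w : Λ} {l : a ⟶ w} {m : b ⟶ w}
    (hl : y ∈ cylinder l) (hm : y ∈ cylinder m) : ∃ t ∈ minExt l m, y ∈ cylinder (t.2.1 ≫ l) := by
  obtain ⟨p, hp⟩ := mem_cylinder_iff.1 hl
  obtain ⟨q, hq⟩ := mem_cylinder_iff.1 hm
  rw [Arrow.mk_eq_mk_iff] at hp
  obtain ⟨rfl, rfl, hp⟩ := hp
  rw [Arrow.mk_eq_mk_iff] at hq
  obtain ⟨rfl, _, hq⟩ := hq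
  simp only [eqToHom_refl, Category.comp_id, Category.id_comp] at hp hq
  subst hp hq
  let n : Omega y.deg := ⟨p.val ⊔ q.val, fun i => by
    rcases le_total (p.val i) (q.val i) with h | h
    · simpa [h] using q.le i
    · simpa [h] using p.le i⟩
  let f : n ⟶ p := ⟨le_sup_left⟩
  let g : n ⟶ q := ⟨le_sup_right⟩
  refine ⟨⟨_, y.path.map f, y.path.map g⟩, ⟨?_, ?_⟩, ?_⟩
  · simp only [map_comp_map_fromZero]
  · simp only [map_comp_map_fromZero, degree_map_fromZero]; rfl
  · simp only [map_comp_map_fromZero]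
    exact mem_cylinder_map y n

theorem exists_mem_cylinder_of_isExhaustive {y : BoundaryPath Λ} {a w : Λ} {m : a ⟶ w}
    (hy : y ∈ cylinder m) {E : Set (PathsInto a)} (hE : E.Finite) (hex : IsExhaustive E)
    (hid : (⟨a, 𝟙 a⟩ : PathsInto a) ∉ E) : ∃ l ∈ E, y ∈ cylinder (l.2 ≫ m) := by
  revert E
  refine cylinder_induction (P := fun {a _} m => ∀ {E : Set (PathsInto a)}, E.Finite →
    IsExhaustive E → (⟨a, 𝟙 a⟩ : PathsInto a) ∉ E → ∃ l ∈ E, y ∈ cylinder (l.2 ≫ m)) ?_ hy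
  intro n E hE hex hid
  obtain ⟨l, hl, q, f, rfl⟩ := y.boundary n E hE hex hid
  refine ⟨_, hl, ?_⟩
  dsimp only
  rw [map_comp_map_fromZero]
  exact mem_cylinder_map y q

theorem exists_val_eq_of_cylinder {x y : BoundaryPath Λ}
    (h : ∀ {a w : Λ} (m : a ⟶ w), x ∈ cylinder m → y ∈ cylinder m) (n : Omega x.deg) :
    ∃ n' : Omega y.deg, n'.val = n.val ∧
      Arrow.mk (x.path.map n.fromZero) = Arrow.mk (y.path.map n'.fromZero) := by
  obtain ⟨n', hn'⟩ := mem_cylinder_iff.1 (h _ (mem_cylinder_map x n))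
  refine ⟨n', ?_, hn'.symm⟩
  have := degree_eq_of_arrow_eq hn'
  rwa [degree_map_fromZero, degree_map_fromZero] at this

theorem deg_le_of_forall_omega {m m' : Fin k → ℕ∞}
    (h : ∀ n : Omega m, ∃ n' : Omega m', n'.val = n.val) : m ≤ m' := by
  intro i
  refine ENat.forall_natCast_le_iff_le.1 fun c hc => ?_
  -- The coordinate may be infinite, so it is tested against vectors supported at `i` with finite
  -- entry `c`.
  obtain ⟨n', hn'⟩ := h ⟨Pi.single i c, fun j => by
    rcases eq_or_ne j i with rfl | hj
    · simpa using hc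
    · simp [hj]⟩
  have := n'.le i
  rw [hn'] at this
  simpa using this

/-- Cylinders record the initial segments `x(0,n)`. Their degrees recover `d(x)`, and cancelling
`x(0,p)` from `x(0,q)` recovers `x(p,q)`. -/
theorem eq_of_forall_cylinder {x y : BoundaryPath Λ}
    (h : ∀ {a w : Λ} (m : a ⟶ w), x ∈ cylinder m ↔ y ∈ cylinder m) : x = y := by
  have hx := exists_val_eq_of_cylinder fun m => (h m).1
  have hy := exists_val_eq_of_cylinder fun m => (h m).2
  refine ext_of_segments (le_antisymm (deg_le_of_forall_omega fun n => ?_)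
    (deg_le_of_forall_omega fun n => ?_)) ?_
  · obtain ⟨n', hn', -⟩ := hx n
    exact ⟨n', hn'⟩
  · obtain ⟨n', hn', -⟩ := hy n
    exact ⟨n', hn'⟩
  · intro p q p' q' f f' hp hq
    obtain ⟨a, ha, ha'⟩ := hx p
    obtain ⟨b, hb, hb'⟩ := hx q
    obtain rfl : a = p' := Omega.ext (ha.trans hp)
    obtain rfl : b = q' := Omega.ext (hb.trans hq)
    refine arrow_eq_of_comp_eq ha' ?_
    rwa [map_comp_map_fromZero, map_comp_map_fromZero]

theorem eq_of_forall_cylinder_of_range {x y : BoundaryPath Λ} {a : Λ} (hx : x ∈ cylinder (𝟙 a))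
    (hy : y ∈ cylinder (𝟙 a))
    (h : ∀ {b : Λ} (l : b ⟶ a), x ∈ cylinder l ↔ y ∈ cylinder l) : x = y := by
  refine eq_of_forall_cylinder fun {b w} l => ⟨fun hl => ?_, fun hl => ?_⟩
  · obtain rfl := (range_eq_of_mem_cylinder hx).symm.trans (range_eq_of_mem_cylinder hl)
    exact (h l).1 hl
  · obtain rfl := (range_eq_of_mem_cylinder hy).symm.trans (range_eq_of_mem_cylinder hl)
    exact (h l).2 hl

theorem shift_mem_cylinder_iff {y : BoundaryPath Λ} {n : Omega y.deg} {b : Λ}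
    {l : b ⟶ y.path.obj n} :
    y.shift n ∈ cylinder l ↔ y ∈ cylinder (l ≫ y.path.map n.fromZero) := by
  rw [mem_cylinder_iff, mem_cylinder_iff]
  have hz : n.add Omega.zero = n := Omega.ext (zero_add _)
  constructor
  · rintro ⟨p, hp⟩
    let g : n.add p ⟶ n := ⟨le_add_self⟩
    have e := (arrow_map_eq y (n.translate.map p.fromZero) g hz rfl).symm.trans hp
    refine ⟨n.add p, ?_⟩
    rw [← map_comp_map_fromZero y g]
    rw [Arrow.mk_eq_mk_iff] at e
    obtain ⟨rfl, _, e⟩ := e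
    simp only [eqToHom_refl, Category.comp_id, Category.id_comp] at e
    rw [e]
  · rintro ⟨q, hq⟩
    have hd := degree_eq_of_arrow_eq hq
    rw [degree_comp, degree_map_fromZero, degree_map_fromZero] at hd
    let p : Omega (y.shift n).deg := ⟨degree l, fun i => by
      have h := q.le i
      rw [hd] at h
      change _ ≤ y.deg i - (n.val i : ℕ∞)
      refine ENat.le_sub_of_add_le_left (ENat.natCast_ne_top _) ?_
      simpa using h⟩
    have hpq : n.add p = q := Omega.ext (by rw [hd]; exact add_comm _ _)
    let g : q ⟶ n := ⟨by rw [hd]; exact le_self_add⟩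
    refine ⟨p, (arrow_map_eq y (n.translate.map p.fromZero) g hz hpq).trans ?_⟩
    refine arrow_eq_of_comp_eq (g := y.path.map n.fromZero) (g' := y.path.map n.fromZero) rfl ?_
    rwa [map_comp_map_fromZero]

theorem IsConcat.mem_cylinder_iff {a b w : Λ} {m : a ⟶ w} {x y : BoundaryPath Λ}
    (h : IsConcat m x y) (l : b ⟶ a) : x ∈ cylinder l ↔ y ∈ cylinder (l ≫ m) := by
  obtain ⟨n, -, h, rfl⟩ := h
  rw [Arrow.mk_eq_mk_iff] at h
  obtain ⟨rfl, rfl, h⟩ := h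
  simp only [eqToHom_refl, Category.comp_id, Category.id_comp] at h
  subst h
  exact shift_mem_cylinder_iff

theorem isConcat_shift (y : BoundaryPath Λ) (n : Omega y.deg) :
    IsConcat (y.path.map n.fromZero) (y.shift n) y :=
  ⟨n, (degree_map_fromZero y n).symm, rfl, rfl⟩

theorem IsConcat.mem_cylinder {a w : Λ} {m : a ⟶ w} {x y : BoundaryPath Λ}
    (h : IsConcat m x y) : y ∈ cylinder m :=
  ⟨x, h⟩

theorem IsConcat.mem_cylinder_id {a w : Λ} {m : a ⟶ w} {x y : BoundaryPath Λ}
    (h : IsConcat m x y) : x ∈ cylinder (𝟙 a) := by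
  rw [h.mem_cylinder_iff, Category.id_comp]
  exact h.mem_cylinder

/-- Membership of `μx` in the cylinder set `Z(ν)` depends on `x` through `Λ^min(μ, ν)`. -/
theorem IsConcat.mem_cylinder_iff_exists_minExt {a b w : Λ} {m : a ⟶ w} {x y : BoundaryPath Λ}
    (h : IsConcat m x y) (l : b ⟶ w) :
    y ∈ cylinder l ↔ ∃ t ∈ minExt m l, x ∈ cylinder t.2.1 := by
  constructor
  · intro hl
    obtain ⟨t, ht, hy⟩ := exists_minExt_of_mem_cylinder h.mem_cylinder hl
    exact ⟨t, ht, (h.mem_cylinder_iff _).2 hy⟩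
  · rintro ⟨t, ht, hx⟩
    rw [h.mem_cylinder_iff, ht.1] at hx
    exact cylinder_comp_subset _ _ hx

theorem IsConcat.right_unique {a w : Λ} {m : a ⟶ w} {x y y' : BoundaryPath Λ}
    (h : IsConcat m x y) (h' : IsConcat m x y') : y = y' :=
  eq_of_forall_cylinder_of_range (cylinder_subset_id m h.mem_cylinder)
    (cylinder_subset_id m h'.mem_cylinder) fun l => by
      rw [h.mem_cylinder_iff_exists_minExt, h'.mem_cylinder_iff_exists_minExt]

theorem IsConcat.left_unique {a w : Λ} {m : a ⟶ w} {x x' y : BoundaryPath Λ}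
    (h : IsConcat m x y) (h' : IsConcat m x' y) : x = x' := by
  obtain ⟨n, hn, -, rfl⟩ := h
  obtain ⟨n', hn', -, rfl⟩ := h'
  rw [Omega.ext (hn.trans hn'.symm)]

end BoundaryPath

/-! ### Boundary filters and the paths they define. -/

/-- A nonempty set of paths with range `w` that is closed under initial segments, directed, and
meets the finite exhaustive sets. These are the sets of initial segments of boundary paths. -/
structure IsBoundaryFilter {w : Λ} (S : Set (PathsInto w)) : Prop where
  id_mem : (⟨w, 𝟙 w⟩ : PathsInto w) ∈ S
  mem_of_comp : ∀ {a b : Λ} (f : b ⟶ a) (g : a ⟶ w),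
    (⟨b, f ≫ g⟩ : PathsInto w) ∈ S → (⟨a, g⟩ : PathsInto w) ∈ S
  directed : ∀ l ∈ S, ∀ m ∈ S, ∃ t ∈ minExt l.2 m.2, (⟨t.1, t.2.1 ≫ l.2⟩ : PathsInto w) ∈ S
  exhaustive : ∀ l ∈ S, ∀ E : Set (PathsInto l.1), E.Finite → IsExhaustive E →
    (⟨l.1, 𝟙 l.1⟩ : PathsInto l.1) ∉ E → ∃ e ∈ E, (⟨e.1, e.2 ≫ l.2⟩ : PathsInto w) ∈ S

theorem pathsInto_eq_of_eq_comp {k : ℕ} {Λ : Type u} [Category.{v} Λ] [HigherRankGraph k Λ]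
    {a w : Λ} {g : a ⟶ w} {P : PathsInto w} {f : P.1 ⟶ a}
    (h : f ≫ g = P.2) {l : PathsInto a} (e : P = ⟨l.1, l.2 ≫ g⟩) :
    (⟨P.1, f⟩ : PathsInto a) = l := by
  subst e
  obtain rfl := comp_right_cancel h
  rfl

theorem arrow_eq_of_comp_eq_of_eq_id {a w : Λ} {P : PathsInto w} {f : a ⟶ P.1}
    (hP : P = ⟨w, 𝟙 w⟩) {l : a ⟶ w} (h : f ≫ P.2 = l) : Arrow.mk f = Arrow.mk l := by
  subst hP
  rw [← h]
  simp

namespace IsBoundaryFilter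

variable {w : Λ} {S : Set (PathsInto w)}

theorem exists_comp_eq (hS : IsBoundaryFilter S) {l m : PathsInto w} (hl : l ∈ S) (hm : m ∈ S)
    (hd : degree l.2 ≤ degree m.2) : ∃ f : m.1 ⟶ l.1, f ≫ l.2 = m.2 := by
  obtain ⟨t, ⟨ht, -⟩, -⟩ := hS.directed l hl m hm
  obtain ⟨p, hp, -⟩ := exists_comp_eq_of_degree_le ht hd
  exact ⟨p, hp⟩

theorem eq_of_degree_eq (hS : IsBoundaryFilter S) {l m : PathsInto w} (hl : l ∈ S) (hm : m ∈ S)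
    (hd : degree l.2 = degree m.2) : l = m := by
  obtain ⟨t, ⟨ht, -⟩, -⟩ := hS.directed l hl m hm
  exact pathsInto_eq_of_comp_eq ht hd

/-- The degree of the boundary path with the given initial segments. -/
noncomputable def supDegree (S : Set (PathsInto w)) (i : Fin k) : ℕ∞ :=
  ⨆ l ∈ S, ((degree l.2 i : ℕ) : ℕ∞)

theorem degree_le_supDegree {l : PathsInto w} (hl : l ∈ S) (i : Fin k) :
    ((degree l.2 i : ℕ) : ℕ∞) ≤ supDegree S i :=
  le_iSup₂ (f := fun (l : PathsInto w) (_ : l ∈ S) => ((degree l.2 i : ℕ) : ℕ∞)) l hl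

theorem exists_le_degree_apply (hS : IsBoundaryFilter S) {i : Fin k} {c : ℕ}
    (hc : (c : ℕ∞) ≤ supDegree S i) : ∃ l ∈ S, c ≤ degree l.2 i := by
  by_contra! h
  obtain rfl | ⟨c, rfl⟩ : c = 0 ∨ ∃ d, c = d + 1 := by
    cases c
    · exact Or.inl rfl
    · exact Or.inr ⟨_, rfl⟩
  · exact absurd (h _ hS.id_mem) (Nat.not_lt_zero _)
  · have : supDegree S i ≤ (c : ℕ∞) :=
      iSup₂_le fun l hl => by exact_mod_cast Nat.lt_succ_iff.1 (h l hl)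
    have := hc.trans this
    norm_cast at this
    omega

/-- The supremum is taken coordinatewise, so each coordinate may need its own member of `S`;
directedness merges these finitely many members. -/
theorem exists_le_degree (hS : IsBoundaryFilter S) (n : Omega (supDegree (k := k) S)) :
    ∃ l ∈ S, n.val ≤ degree l.2 := by
  have : ∀ s : Finset (Fin k), ∃ l ∈ S, ∀ i ∈ s, n.val i ≤ degree l.2 i := by
    intro s
    induction s using Finset.induction_on with
    | empty => exact ⟨_, hS.id_mem, by simp⟩
    | insert i s _ ih =>
      obtain ⟨l, hl, hls⟩ := ih
      obtain ⟨m, hm, hmi⟩ := hS.exists_le_degree_apply (n.le i)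
      obtain ⟨t, ⟨-, ht⟩, htS⟩ := hS.directed l hl m hm
      refine ⟨_, htS, fun j hj => ?_⟩
      dsimp only
      rw [ht]
      rcases Finset.mem_insert.1 hj with rfl | hj
      · exact le_sup_of_le_right hmi
      · exact le_sup_of_le_left (hls j hj)
  obtain ⟨l, hl, h⟩ := this Finset.univ
  exact ⟨l, hl, fun i => h i (Finset.mem_univ i)⟩

theorem exists_degree_eq (hS : IsBoundaryFilter S) (n : Omega (supDegree (k := k) S)) :
    ∃ l ∈ S, degree l.2 = n.val := by
  obtain ⟨⟨a, l⟩, hl, hn⟩ := hS.exists_le_degree n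
  obtain ⟨c, p, q, rfl, hq⟩ := exists_initial_segment l hn
  exact ⟨⟨c, q⟩, hS.mem_of_comp p q hl, hq⟩

/-- Directedness leaves exactly one member `L n` of `S` in each degree `n ≤ supDegree S`. These
serve as the initial segments; the connecting paths `φ` come from factorisation, and cancelling
makes them functorial. -/
theorem exists_boundaryPath (hS : IsBoundaryFilter S) :
    ∃ y : BoundaryPath Λ, ∀ l : PathsInto w, y ∈ BoundaryPath.cylinder l.2 ↔ l ∈ S := by
  choose L hLS hLd using hS.exists_degree_eq
  have hLf : ∀ {p q : Omega (supDegree S)} (_ : q ⟶ p), ∃ f : (L q).1 ⟶ (L p).1,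
      f ≫ (L p).2 = (L q).2 := fun {p q} f =>
    hS.exists_comp_eq (hLS p) (hLS q) (by rw [hLd, hLd]; exact f.down)
  choose φ hφ using @hLf
  have hL : ∀ l (hl : l ∈ S), L ⟨degree l.2, degree_le_supDegree hl⟩ = l := fun l hl =>
    hS.eq_of_degree_eq (hLS _) hl (hLd _)
  have hL0 : L Omega.zero = ⟨w, 𝟙 w⟩ := eq_id_of_degree_eq_zero _ (hLd _)
  let y : BoundaryPath Λ :=
    { deg := supDegree S
      path :=
        { obj := fun p => (L p).1
          map := fun f => φ f
          map_id := fun p => comp_right_cancel (g := (L p).2) (by rw [hφ, Category.id_comp])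
          map_comp := fun {p q r} f g =>
            comp_right_cancel (g := (L r).2) (by rw [Category.assoc, hφ, hφ, hφ])
          degree_map := fun {p q} f => by
            have := congrArg degree (hφ f)
            rw [degree_comp, hLd, hLd] at this
            exact eq_tsub_of_add_eq ((add_comm _ _).trans this) }
      boundary := fun n E hE hex hid => by
        obtain ⟨e, he, heS⟩ := hS.exhaustive _ (hLS n) E hE hex hid
        let q : Omega (supDegree S) := ⟨_, degree_le_supDegree heS⟩
        let f : q ⟶ n := ⟨by
          change n.val ≤ degree (e.2 ≫ (L n).2)
          rw [degree_comp, hLd]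
          exact le_self_add⟩
        refine ⟨e, he, q, f, ?_⟩
        exact pathsInto_eq_of_eq_comp (hφ f) (hL _ heS) }
  have hy : ∀ n : Omega (supDegree S), Arrow.mk (y.path.map (Omega.fromZero n)) =
      Arrow.mk (L n).2 := fun n =>
    arrow_eq_of_comp_eq_of_eq_id (f := φ n.fromZero) hL0 (hφ _)
  refine ⟨y, fun l => ?_⟩
  rw [BoundaryPath.mem_cylinder_iff]
  constructor
  · rintro ⟨n, hn⟩
    have : L n = l := pathsInto_eq_of_arrow_eq ((hy n).symm.trans hn)
    exact this ▸ hLS n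
  · intro hl
    exact ⟨⟨degree l.2, degree_le_supDegree hl⟩,
      (hy _).trans (arrow_eq_of_pathsInto_eq (hL l hl))⟩

end IsBoundaryFilter

/-! ### Existence of concatenations. -/

namespace BoundaryPath

/-- The set consists of the initial segments of the paths `μf`, with `f` an initial segment of `x`.
To meet an exhaustive `E`, pull it back along `g` to a set at the source of `f`, finite by finite
alignment, and use the boundary property of `x`. -/
theorem isBoundaryFilter_concat (hΛ : FinitelyAligned Λ) {a w : Λ} (m : a ⟶ w)
    {x : BoundaryPath Λ} (hx : x ∈ cylinder (𝟙 a)) :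
    IsBoundaryFilter {l : PathsInto w | ∃ (c : Λ) (f : c ⟶ a) (g : c ⟶ l.1),
      x ∈ cylinder f ∧ f ≫ m = g ≫ l.2} where
  id_mem := ⟨a, 𝟙 a, m, hx, by simp⟩
  mem_of_comp := by
    rintro b c p q ⟨d, f, g, hf, h⟩
    exact ⟨d, f, g ≫ p, hf, by rw [h, Category.assoc]⟩
  directed := by
    rintro ⟨b, l⟩ ⟨c, f, g, hf, h⟩ ⟨b', l'⟩ ⟨c', f', g', hf', h'⟩
    dsimp only at g g' h h' ⊢
    obtain ⟨t, ⟨ht, -⟩, hxt⟩ := exists_minExt_of_mem_cylinder hf hf'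
    have e : (t.2.1 ≫ g) ≫ l = (t.2.2 ≫ g') ≫ l' := by
      rw [Category.assoc, ← h, ← Category.assoc, ht, Category.assoc, h', Category.assoc]
    obtain ⟨s, hs, p, hp, -⟩ := exists_minExt_of_comp_eq e
    refine ⟨s, hs, t.1, t.2.1 ≫ f, p, hxt, ?_⟩
    dsimp only
    rw [← Category.assoc, hp, Category.assoc, h, Category.assoc]
  exhaustive := by
    rintro ⟨b, l⟩ ⟨c, f, g, hf, h⟩ E hE hex -
    dsimp only at g h E hE hex ⊢
    have key : ∃ r ∈ extensions g E, x ∈ cylinder (r.2 ≫ f) := by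
      -- The boundary property does not apply to a set containing the vertex, but then `f` itself
      -- already reaches `E`.
      by_cases hid : (⟨c, 𝟙 c⟩ : PathsInto c) ∈ extensions g E
      · exact ⟨_, hid, by simpa using hf⟩
      · exact exists_mem_cylinder_of_isExhaustive hf (extensions_finite hΛ g hE)
          (hex.extensions g) hid
    obtain ⟨r, hr, hxr⟩ := key
    obtain ⟨e, he, t, ⟨ht, -⟩, rfl⟩ := Set.mem_iUnion₂.1 hr
    refine ⟨e, he, t.1, t.2.1 ≫ f, t.2.2, hxr, ?_⟩
    rw [Category.assoc, h, ← Category.assoc, ht, Category.assoc]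

theorem exists_isConcat (hΛ : FinitelyAligned Λ) {a w : Λ} (m : a ⟶ w) {x : BoundaryPath Λ}
    (hx : x ∈ cylinder (𝟙 a)) : ∃ y, IsConcat m x y := by
  obtain ⟨y, hy⟩ := (isBoundaryFilter_concat hΛ m hx).exists_boundaryPath
  obtain ⟨x', hx'⟩ : y ∈ cylinder m := (hy ⟨a, m⟩).2 ⟨a, 𝟙 a, 𝟙 a, hx, rfl⟩
  suffices x = x' by
    subst this
    exact ⟨y, hx'⟩
  refine eq_of_forall_cylinder_of_range hx hx'.mem_cylinder_id fun {b} l => ?_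
  rw [hx'.mem_cylinder_iff, hy ⟨b, l ≫ m⟩]
  constructor
  · exact fun hl => ⟨b, l, 𝟙 b, hl, by simp⟩
  · rintro ⟨c, f, g, hf, h⟩
    dsimp only at g h
    rw [← Category.assoc] at h
    rw [comp_right_cancel h] at hf
    exact cylinder_comp_subset _ _ hf

end BoundaryPath

namespace BoundaryPath

/-! ### The Hausdorff topology and compactness of vertex cylinders. -/

section Topology

open Topology

theorem isOpen_cylinderDiff {a w : Λ} (m : a ⟶ w) {F : Set (PathsInto a)} (hF : F.Finite) :
    IsOpen (cylinderDiff (k := k) m F) :=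
  TopologicalSpace.isOpen_generateFrom_of_mem ⟨a, w, m, F, hF, rfl⟩

theorem isOpen_cylinder {a w : Λ} (m : a ⟶ w) : IsOpen (cylinder (k := k) m) := by
  simpa [cylinderDiff] using isOpen_cylinderDiff (k := k) m Set.finite_empty

theorem isClosed_cylinder {a w : Λ} (m : a ⟶ w) : IsClosed (cylinder (k := k) m) := by
  refine ⟨isOpen_iff_forall_mem_open.2 fun y hy => ?_⟩
  by_cases hw : y.path.obj Omega.zero = w
  · refine ⟨_, ?_, isOpen_cylinderDiff (𝟙 w) (Set.finite_singleton (⟨a, m⟩ : PathsInto w)), ?_⟩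
    · rintro z ⟨-, hz⟩
      simpa using hz
    · exact ⟨mem_cylinder_id_iff.2 hw, by simpa using hy⟩
  · refine ⟨_, ?_, isOpen_cylinder (𝟙 (y.path.obj Omega.zero)), mem_cylinder_id_iff.2 rfl⟩
    intro z hz hzm
    exact hw ((range_eq_of_mem_cylinder hz).symm.trans (range_eq_of_mem_cylinder hzm))

instance : T2Space (BoundaryPath Λ) where
  t2 x y hxy := by
    obtain ⟨a, w, m, h⟩ : ∃ (a w : Λ) (m : a ⟶ w), ¬(x ∈ cylinder m ↔ y ∈ cylinder m) := by
      by_contra! h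
      exact hxy (eq_of_forall_cylinder fun {a w} m => h a w m)
    by_cases hx : x ∈ cylinder m
    · have hy : y ∉ cylinder m := fun hy => h ⟨fun _ => hy, fun _ => hx⟩
      exact ⟨_, _, isOpen_cylinder m, (isClosed_cylinder m).isOpen_compl, hx, hy,
        disjoint_compl_right⟩
    · have hy : y ∈ cylinder m := by_contra fun hy => h ⟨fun h => absurd h hx, fun h => absurd h hy⟩
      exact ⟨_, _, (isClosed_cylinder m).isOpen_compl, isOpen_cylinder m, hx, hy,
        disjoint_compl_left⟩

/-- Openness of the preimages would not suffice, since the basic sets `Z(μ ∖ F)` also remove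
cylinders. -/
theorem continuous_of_isClopen_preimage_cylinder {X : Type*} [TopologicalSpace X]
    {f : X → BoundaryPath Λ} (h : ∀ {a w : Λ} (m : a ⟶ w), IsClopen (f ⁻¹' cylinder m)) :
    Continuous f := by
  refine continuous_generateFrom_iff.2 ?_
  rintro _ ⟨a, w, m, F, hF, rfl⟩
  rw [cylinderDiff, Set.preimage_sdiff, Set.preimage_iUnion₂]
  exact (h m).isOpen.sdiff (hF.isClosed_biUnion fun n _ => (h _).isClosed)

/-- An ultrafilter containing a finite union contains one of its members. Finite alignment makes the
union for directedness finite; the boundary property supplies the union for exhaustive sets. -/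
theorem isBoundaryFilter_ultrafilter (hΛ : FinitelyAligned Λ) {w : Λ}
    (U : Ultrafilter (BoundaryPath Λ)) (hU : cylinder (𝟙 w) ∈ U) :
    IsBoundaryFilter {l : PathsInto w | cylinder l.2 ∈ U} where
  id_mem := hU
  mem_of_comp f g h := Filter.mem_of_superset h (cylinder_comp_subset f g)
  directed := by
    intro l hl m hm
    have : (⋃ t ∈ minExt l.2 m.2, cylinder (t.2.1 ≫ l.2)) ∈ U := by
      refine Filter.mem_of_superset (Filter.inter_mem hl hm) ?_
      rintro y ⟨hyl, hym⟩
      obtain ⟨t, ht, hy⟩ := exists_minExt_of_mem_cylinder hyl hym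
      exact Set.mem_biUnion ht hy
    exact (Ultrafilter.finite_biUnion_mem_iff (hΛ l.2 m.2)).1 this
  exhaustive := by
    intro l hl E hE hex hid
    have : (⋃ e ∈ E, cylinder (e.2 ≫ l.2)) ∈ U := by
      refine Filter.mem_of_superset hl fun y hy => ?_
      obtain ⟨e, he, hy⟩ := exists_mem_cylinder_of_isExhaustive hy hE hex hid
      exact Set.mem_biUnion he hy
    exact (Ultrafilter.finite_biUnion_mem_iff hE).1 this

/-- An ultrafilter on `Z(w)` converges to the boundary path whose initial segments are the `l` with
`Z(l)` in the ultrafilter. -/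
theorem isCompact_cylinder_id (hΛ : FinitelyAligned Λ) (w : Λ) :
    IsCompact (cylinder (k := k) (𝟙 w)) := by
  refine isCompact_iff_ultrafilter_le_nhds'.2 fun U hU => ?_
  obtain ⟨y, hy⟩ := (isBoundaryFilter_ultrafilter hΛ U hU).exists_boundaryPath
  have hyw : y ∈ cylinder (𝟙 w) := (hy ⟨w, 𝟙 w⟩).2 hU
  refine ⟨y, hyw, ?_⟩
  rw [TopologicalSpace.nhds_generateFrom]
  refine le_iInf₂ ?_
  rintro _ ⟨hyV, a, w', m, F, hF, rfl⟩
  rw [Filter.le_principal_iff]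
  obtain rfl := (range_eq_of_mem_cylinder hyw).symm.trans (range_eq_of_mem_cylinder hyV.1)
  have hn : ∀ n ∈ F, (cylinder (n.2 ≫ m))ᶜ ∈ (U : Filter (BoundaryPath Λ)) := fun n hn =>
    Ultrafilter.compl_mem_iff_notMem.2 fun h =>
      hyV.2 (Set.mem_biUnion hn ((hy ⟨n.1, n.2 ≫ m⟩).2 h))
  rw [cylinderDiff, Set.sdiff_eq, Set.compl_iUnion₂]
  exact Filter.inter_mem ((hy ⟨a, m⟩).1 hyV.1) ((Filter.biInter_mem hF).2 hn)

end Topology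

/-! ### Closed orbits and finiteness. -/

section Orbit

theorem mem_orbit_iff {x y : BoundaryPath Λ} :
    y ∈ orbit x ↔ ∃ (p : Omega y.deg) (q : Omega x.deg), y.shift p = x.shift q :=
  ⟨fun ⟨_, p, q, _, h⟩ => ⟨p, q, h⟩, fun ⟨p, q, h⟩ => ⟨⟨_, p, q, fun _ => rfl, h⟩⟩⟩

theorem mem_orbit_iff_exists_isConcat {x y : BoundaryPath Λ} :
    y ∈ orbit x ↔ ∃ (a b c : Λ) (l : a ⟶ b) (m : a ⟶ c) (z : BoundaryPath Λ),
      IsConcat l z x ∧ IsConcat m z y := by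
  rw [mem_orbit_iff]
  constructor
  · rintro ⟨p, q, h⟩
    have hx := isConcat_shift x q
    have hy := isConcat_shift y p
    rw [h] at hy
    -- The two initial segments have sources that agree only propositionally; forgetting their
    -- concrete form allows substitution.
    obtain ⟨a, b, l, hl⟩ : ∃ (a b : Λ) (l : a ⟶ b), IsConcat l (x.shift q) x := ⟨_, _, _, hx⟩
    obtain ⟨a', c, m, hm⟩ : ∃ (a b : Λ) (l : a ⟶ b), IsConcat l (x.shift q) y := ⟨_, _, _, hy⟩
    obtain rfl := (range_eq_of_mem_cylinder hl.mem_cylinder_id).symm.trans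
      (range_eq_of_mem_cylinder hm.mem_cylinder_id)
    exact ⟨_, _, _, l, m, _, hl, hm⟩
  · rintro ⟨a, b, c, l, m, z, ⟨q, -, -, hq⟩, ⟨p, -, -, hp⟩⟩
    exact ⟨p, q, hp.trans hq.symm⟩

theorem orbit_eq_of_mem {x y : BoundaryPath Λ} (h : y ∈ orbit x) : orbit y = orbit x := by
  obtain ⟨f⟩ := h
  ext z
  exact ⟨fun ⟨g⟩ => ⟨f ≫ g⟩, fun ⟨g⟩ => ⟨Groupoid.inv f ≫ g⟩⟩

instance {m : Fin k → ℕ∞} : Countable (Omega m) :=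
  Function.Injective.countable (f := Omega.val) fun _ _ => Omega.ext

/-- Each orbit point is `μσ^q(x)` for some `μ` and `q`, and is determined by this countable data. -/
theorem countable_orbit [Countable Λ] [∀ a b : Λ, Countable (a ⟶ b)] (x : BoundaryPath Λ) :
    (orbit x).Countable := by
  have : orbit x ⊆ ⋃ (q : Omega x.deg) (m : Σ a b : Λ, (a ⟶ b)),
      {y | IsConcat m.2.2 (x.shift q) y} := by
    intro y hy
    obtain ⟨p, q, h⟩ := mem_orbit_iff.1 hy
    refine Set.mem_iUnion₂.2 ⟨q, ⟨_, _, y.path.map p.fromZero⟩, ?_⟩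
    rw [← h]
    exact isConcat_shift y p
  refine Set.Countable.mono this (Set.countable_iUnion fun q => Set.countable_iUnion fun m => ?_)
  exact Set.Subsingleton.countable fun y hy z hz => IsConcat.right_unique hy hz

/-- The map `λx ↦ μx` from `Z(λ)` to `Z(μ)` is continuous. -/
theorem exists_continuous_isConcat (hΛ : FinitelyAligned Λ) {a b c : Λ} (l : a ⟶ b) (m : a ⟶ c) :
    ∃ φ : cylinder (k := k) l → BoundaryPath Λ, Continuous φ ∧
      ∀ z : cylinder (k := k) l, ∃ x, IsConcat l x z ∧ IsConcat m x (φ z) := by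
  have h : ∀ z : cylinder (k := k) l, ∃ y x, IsConcat l x z ∧ IsConcat m x y := fun z => by
    obtain ⟨x, hx⟩ := z.2
    obtain ⟨y, hy⟩ := exists_isConcat hΛ m hx.mem_cylinder_id
    exact ⟨y, x, hx, hy⟩
  choose φ hφ using h
  refine ⟨φ, continuous_of_isClopen_preimage_cylinder fun {d w} n => ?_, hφ⟩
  by_cases hw : c = w
  · subst hw
    -- Finite alignment makes this union finite, hence clopen.
    have : φ ⁻¹' cylinder n = Subtype.val ⁻¹' ⋃ t ∈ minExt m n, cylinder (t.2.1 ≫ l) := by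
      ext z
      obtain ⟨x, hx, hy⟩ := hφ z
      simp only [Set.mem_preimage, Set.mem_iUnion, exists_prop,
        hy.mem_cylinder_iff_exists_minExt, hx.mem_cylinder_iff]
    rw [this]
    exact IsClopen.preimage ((hΛ m n).isClopen_biUnion fun t _ =>
      ⟨isClosed_cylinder _, isOpen_cylinder _⟩) continuous_subtype_val
  · convert isClopen_empty
    refine Set.eq_empty_of_forall_notMem fun z hz => hw ?_
    obtain ⟨x, -, hy⟩ := hφ z
    exact (range_eq_of_mem_cylinder hy.mem_cylinder).symm.trans (range_eq_of_mem_cylinder hz)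

/-- Write `y = ms` and `z = ls`. The map `lt ↦ mt` is continuous, injective and stays within orbits,
so the preimage of `U` isolates `z`. -/
theorem exists_isOpen_inter_orbit_eq_singleton (hΛ : FinitelyAligned Λ) {x y z : BoundaryPath Λ}
    (hy : y ∈ orbit x) (hz : z ∈ orbit x) {U : Set (BoundaryPath Λ)} (hU : IsOpen U)
    (hUy : U ∩ orbit x = {y}) : ∃ W : Set (BoundaryPath Λ), IsOpen W ∧ W ∩ orbit x = {z} := by
  obtain ⟨a, b, c, m, l, s, hm, hl⟩ := mem_orbit_iff_exists_isConcat.1 (orbit_eq_of_mem hy ▸ hz)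
  obtain ⟨φ, hφ, h⟩ := exists_continuous_isConcat hΛ l m
  have hyU : y ∈ U := (hUy.symm ▸ Set.mem_singleton y : y ∈ U ∩ orbit x).1
  refine ⟨Subtype.val '' (φ ⁻¹' U),
    (isOpen_cylinder l).isOpenEmbedding_subtypeVal.isOpenMap _ (hU.preimage hφ), ?_⟩
  refine Set.Subset.antisymm ?_ ?_
  · rintro _ ⟨⟨z', hz', rfl⟩, hzx⟩
    obtain ⟨t, ht, ht'⟩ := h z'
    have : φ z' ∈ U ∩ orbit x :=
      ⟨hz', orbit_eq_of_mem hzx ▸ mem_orbit_iff_exists_isConcat.2 ⟨_, _, _, _, _, _, ht, ht'⟩⟩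
    rw [hUy, Set.mem_singleton_iff] at this
    rw [this] at ht'
    obtain rfl := ht'.left_unique hm
    exact ht.right_unique hl
  · rintro _ rfl
    refine ⟨⟨⟨_, hl.mem_cylinder⟩, ?_, rfl⟩, hz⟩
    obtain ⟨t, ht, ht'⟩ := h ⟨_, hl.mem_cylinder⟩
    obtain rfl := ht.left_unique hl
    rw [Set.mem_preimage, ht'.right_unique hm]
    exact hyU

theorem finite_cylinder_inter_orbit_of_isClosed [Countable Λ] [∀ a b : Λ, Countable (a ⟶ b)]
    (hΛ : FinitelyAligned Λ) {x : BoundaryPath Λ} (hx : IsClosed (orbit x)) (w : Λ) :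
    (cylinder (𝟙 w) ∩ orbit x).Finite := by
  set K := cylinder (𝟙 w) ∩ orbit x with hK
  have hKc : IsCompact K := (isCompact_cylinder_id hΛ w).inter_right hx
  rcases K.eq_empty_or_nonempty with h | hne
  · exact h ▸ Set.finite_empty
  have : CompactSpace K := isCompact_iff_compactSpace.1 hKc
  have : Countable K := ((countable_orbit x).mono Set.inter_subset_right).to_subtype
  have : Nonempty K := hne.to_subtype
  -- Baire category: `K` is a countable union of closed singletons, so one of them has interior.
  obtain ⟨y, hy⟩ := nonempty_interior_of_iUnion_of_closed (f := fun y : K => ({y} : Set K))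
    (fun _ => isClosed_singleton) (Set.iUnion_of_singleton K)
  have hyo : IsOpen ({y} : Set K) := by
    rw [← interior_eq_iff_isOpen]
    exact (Set.subset_singleton_iff_eq.1 interior_subset).resolve_left hy.ne_empty
  obtain ⟨U, hU, hUy⟩ := isOpen_induced_iff.1 hyo
  -- Intersecting with the open set `Z(w)` isolates `y` in the whole orbit, as transport requires.
  have hUK : (U ∩ cylinder (𝟙 w)) ∩ orbit x = {y.1} := by
    rw [Set.inter_assoc, Set.inter_comm, ← hK, ← Subtype.image_preimage_coe, hUy,
      Set.image_singleton]
  have : DiscreteTopology K := discreteTopology_iff_isOpen_singleton.2 fun z => by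
    obtain ⟨W, hW, hWz⟩ := exists_isOpen_inter_orbit_eq_singleton hΛ y.2.2 z.2.2
      (hU.inter (isOpen_cylinder (𝟙 w))) hUK
    refine isOpen_induced_iff.2 ⟨W, hW, ?_⟩
    ext t
    have ht := Set.ext_iff.1 hWz t.1
    simp only [Set.mem_inter_iff, t.2.2, and_true, Set.mem_singleton_iff] at ht
    simp [ht, Subtype.ext_iff]
  have : Finite K := finite_of_compact_of_discrete
  exact K.toFinite

theorem isClosed_orbit_of_finite_cylinder_inter {x : BoundaryPath Λ}
    (h : ∀ w : Λ, (cylinder (𝟙 w) ∩ orbit x).Finite) : IsClosed (orbit x) := by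
  refine ⟨isOpen_iff_forall_mem_open.2 fun y hy => ?_⟩
  let w := y.path.obj Omega.zero
  refine ⟨cylinder (𝟙 w) \ (cylinder (𝟙 w) ∩ orbit x), fun z hz hzx => hz.2 ⟨hz.1, hzx⟩,
    (isOpen_cylinder _).sdiff (h w).isClosed, mem_cylinder_id_iff.2 rfl, fun h => hy h.2⟩

end Orbit

end BoundaryPath

end PathSpace

/-! ### Closed points of the orbit space. -/

theorem t1Space_orbitSpace_iff {G : Type u} [Groupoid.{v} G] [TopologicalSpace G] :
    T1Space (OrbitSpace G) ↔ ∀ x : G, IsClosed (orbit x) := by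
  have key : ∀ x : G, IsClosed ({Quotient.mk (orbitSetoid G) x} : Set (OrbitSpace G)) ↔ IsClosed (orbit x) := by
    intro x
    let _ : Setoid G := orbitSetoid G
    rw [← isQuotientMap_quotient_mk'.isClosed_preimage]
    have : (Quotient.mk' : G → OrbitSpace G) ⁻¹' {Quotient.mk _ x} = orbit x := by
      ext y
      rw [Set.mem_preimage, Set.mem_singleton_iff, eq_comm]
      exact Quotient.eq
    rw [this]
  refine ⟨fun _ x => (key x).1 isClosed_singleton, fun h => ⟨fun q => ?_⟩⟩
  obtain ⟨x, rfl⟩ := Quotient.exists_rep q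
  exact (key x).2 (h x)

end HRG

theorem propositionp {k : ℕ} (Λ : Type u) [CategoryTheory.Category.{v} Λ]
    [HRG.HigherRankGraph k Λ] [Countable Λ] [∀ a b : Λ, Countable (a ⟶ b)]
    (hΛ : HRG.FinitelyAligned Λ) :
    T1Space (HRG.OrbitSpace (HRG.BoundaryPath Λ)) ↔
      ∀ (x : HRG.BoundaryPath Λ) (w : Λ),
        (HRG.BoundaryPath.cylinder (𝟙 w) ∩ HRG.orbit x).Finite := by
  rw [HRG.t1Space_orbitSpace_iff]
  exact ⟨fun h x w => HRG.BoundaryPath.finite_cylinder_inter_orbit_of_isClosed hΛ (h x) w,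
    fun h x => HRG.BoundaryPath.isClosed_orbit_of_finite_cylinder_inter (h x)⟩
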